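/- Let $n\ge 5$. For a word $w$ in the free group of finite rank $k$ and a group $G$, write $w(G)=\{w(g_1,\dots,g_k): g_1,\dots,g_k\in G\}$ for the image of the associated word map $G^k\to G$. Let $S_n$ be the symmetric group and $A_n$ the alternating group of degree $n$, and let $C$ be the set of all elements of $S_n$ whose order is a power of $2$ (including the identity). Call a subset of $S_n$ $\operatorname{Aut}(S_n)$-invariant if it is mapped into itself by every automorphism of $S_n$. Then a subset $A\subseteq S_n$ is of the form $A=w(S_n)$ for some word $w$ in finitely many variables if and only if one of the following holds: (i) $A$ is an $\operatorname{Aut}(S_n)$-invariant subset of $A_n$ containing the identity; or (ii) $A=B\cup C$ for some $\operatorname{Aut}(S_n)$-invariant subset $B\subseteq S_n$. -/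

import Mathlib

/-- The word map `G ^ k → G` of a word `w` in the free group of rank `k`: it substitutes
the `i`-th entry of a tuple for the `i`-th free generator. -/
def wordMap {k : ℕ} (w : FreeGroup (Fin k)) (G : Type*) [Group G] (g : Fin k → G) : G :=
  FreeGroup.lift g w

/-- The verbal image `w(G)`: the set of all values of the word `w` in `G`. -/
def verbalImage {k : ℕ} (w : FreeGroup (Fin k)) (G : Type*) [Group G] : Set G :=
  Set.range (wordMap w G)

/-- `A` is the image over `G` of the word map of some word in finitely many variables. -/
def IsVerbalImage {G : Type*} [Group G] (A : Set G) : Prop :=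
  ∃ (k : ℕ) (w : FreeGroup (Fin k)), verbalImage w G = A

/-- `A` is closed under all automorphisms of `G`, inner or not. -/
def IsAutInvariant {G : Type*} [Group G] (A : Set G) : Prop :=
  ∀ φ : MulAut G, ∀ a ∈ A, φ a ∈ A

/-- The elements whose order is a power of `2`, including the identity. -/
def twoPowerElements (G : Type*) [Group G] : Set G :=
  {g | ∃ m : ℕ, orderOf g = 2 ^ m}

/-! If a word has an odd value, substituting powers of one element turns it into an odd power map,
which is onto the elements of 2-power order. Conversely, take a word `w * x ^ m` whose powers `g ^
m` all lie in `A`: `m = 0` in case (i), an odd `m` killing odd parts in case (ii). The factor `w`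
corrects `a ^ m` to `a` on one generating tuple per `a ∈ A` and dies off their automorphism orbits.
It exists because the alternating group is perfect and lies in every nontrivial normal subgroup
(`exists_word_supported_on_orbit`). -/

theorem isVerbalImage_range_lift {X G : Type*} [Finite X] [Group G] (w : FreeGroup X) :
    IsVerbalImage (Set.range fun s : X → G => FreeGroup.lift s w) := by
  let e := Finite.equivFin X
  have key (g : Fin (Nat.card X) → G) :
      FreeGroup.lift g (FreeGroup.map e w) = FreeGroup.lift (g ∘ e) w := by
    rw [← MonoidHom.comp_apply]
    congr 1
    ext x
    simp
  refine ⟨Nat.card X, FreeGroup.map e w, Set.ext fun y => ⟨?_, ?_⟩⟩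
  · rintro ⟨g, rfl⟩
    exact ⟨g ∘ e, (key g).symm⟩
  · rintro ⟨s, rfl⟩
    refine ⟨s ∘ e.symm, (key _).trans ?_⟩
    simp [Function.comp_assoc]

theorem map_lift_apply {X G H : Type*} [Group G] [Group H] (φ : G →* H) (s : X → G)
    (w : FreeGroup X) : φ (FreeGroup.lift s w) = FreeGroup.lift (fun x => φ (s x)) w := by
  rw [← MonoidHom.comp_apply]
  congr 1
  ext x
  simp

theorem verbalImage_isAutInvariant {k : ℕ} (w : FreeGroup (Fin k)) (G : Type*) [Group G] :
    IsAutInvariant (verbalImage w G) := by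
  rintro φ _ ⟨g, rfl⟩
  exact ⟨fun i => φ (g i), (map_lift_apply φ.toMonoidHom g w).symm⟩

theorem one_mem_verbalImage {k : ℕ} (w : FreeGroup (Fin k)) (G : Type*) [Group G] :
    1 ∈ verbalImage w G := by
  refine ⟨fun _ => 1, ?_⟩
  have := map_lift_apply (1 : G →* G) (fun _ => 1) w
  simpa [wordMap] using this.symm

theorem twoPowerElements_isAutInvariant (G : Type*) [Group G] :
    IsAutInvariant (twoPowerElements G) := by
  rintro φ a ⟨m, hm⟩
  exact ⟨m, by rw [← hm]; exact MulEquiv.orderOf_eq φ a⟩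

theorem exists_zpow_eq_of_orderOf_eq_two_pow {G : Type*} [Group G] {c : G} {m : ℕ}
    (hc : orderOf c = 2 ^ m) {e : ℤ} (he : Odd e) : ∃ d : G, d ^ e = c := by
  have hcop : IsCoprime e ((2 : ℤ) ^ m) :=
    (Int.isCoprime_two_right.mpr he).pow_right
  obtain ⟨u, v, huv⟩ := hcop
  refine ⟨c ^ u, ?_⟩
  have hone : c ^ ((2 : ℤ) ^ m) = 1 := by
    have := pow_orderOf_eq_one c
    rw [hc] at this
    exact_mod_cast this
  rw [← zpow_mul, eq_sub_of_add_eq huv, zpow_sub, mul_comm v, zpow_mul, hone]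
  simp

theorem twoPowerElements_subset_verbalImage {α : Type*} [Fintype α] [DecidableEq α] {k : ℕ}
    (w : FreeGroup (Fin k))
    (hw : ¬ verbalImage w (Equiv.Perm α) ⊆ (alternatingGroup α : Set (Equiv.Perm α))) :
    twoPowerElements (Equiv.Perm α) ⊆ verbalImage w (Equiv.Perm α) := by
  classical
  obtain ⟨_, ⟨g, rfl⟩, hg⟩ := Set.not_subset.mp hw
  -- `e` is the total exponent in `w` of the generators sent to odd permutations, so its parity is
  -- the sign of the value.
  let θ : Fin k → Multiplicative ℤ := fun i =>
    if Equiv.Perm.sign (g i) = 1 then 1 else Multiplicative.ofAdd 1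
  let e : ℤ := (FreeGroup.lift θ w).toAdd
  have hsign : Equiv.Perm.sign (FreeGroup.lift g w) = (-1) ^ e := by
    have h := map_lift_apply (zpowersHom ℤˣ (-1)) θ w
    rw [zpowersHom_apply] at h
    rw [h, map_lift_apply]
    congr 2
    funext i
    rcases Int.units_eq_one_or (Equiv.Perm.sign (g i)) with hi | hi <;> simp [θ, hi]
  have he : Odd e := by
    by_contra hne
    rw [Int.not_odd_iff_even] at hne
    apply hg
    rw [SetLike.mem_coe, Equiv.Perm.mem_alternatingGroup]
    exact hsign.trans hne.neg_one_zpow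
  rintro c ⟨m, hm⟩
  obtain ⟨d, rfl⟩ := exists_zpow_eq_of_orderOf_eq_two_pow hm he
  exact ⟨fun i => zpowersHom _ d (θ i), (map_lift_apply (zpowersHom _ d) θ w).symm⟩

/-- Comparing kernel indices shows that `s` generates too; `t` then factors through `s` by a
surjective endomorphism of a finite group. -/
theorem exists_mulAut_of_ker_lift_le {X G : Type*} [Group G] [Finite G] {s t : X → G}
    (ht : Function.Surjective (FreeGroup.lift t))
    (h : (FreeGroup.lift s).ker ≤ (FreeGroup.lift t).ker) :
    ∃ φ : MulAut G, ∀ x, φ (t x) = s x := by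
  have hs : Function.Surjective (FreeGroup.lift s) := by
    rw [← MonoidHom.range_eq_top]
    apply Subgroup.eq_top_of_le_card
    have hidx : (FreeGroup.lift s).ker.index ≠ 0 := by
      rw [Subgroup.index_ker]
      exact Nat.card_pos.ne'
    have := Nat.le_of_dvd (Nat.pos_of_ne_zero hidx) (Subgroup.index_dvd_of_le h)
    rwa [Subgroup.index_ker, Subgroup.index_ker, MonoidHom.range_eq_top.mpr ht,
      Subgroup.card_top] at this
  let ψ : G →* G := (FreeGroup.lift s).liftOfSurjective hs ⟨FreeGroup.lift t, h⟩
  have hψ (w : FreeGroup X) : ψ (FreeGroup.lift s w) = FreeGroup.lift t w :=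
    MonoidHom.liftOfRightInverse_comp_apply _ _ (Function.rightInverse_surjInv hs) _ w
  have hsurj : Function.Surjective ψ := fun y => by
    obtain ⟨w, rfl⟩ := ht y
    exact ⟨_, hψ w⟩
  have hbij : Function.Bijective ψ := ⟨Finite.injective_iff_surjective.mpr hsurj, hsurj⟩
  refine ⟨(MulEquiv.ofBijective ψ hbij).symm, fun x => ?_⟩
  rw [MulEquiv.symm_apply_eq]
  simpa using (hψ (FreeGroup.of x)).symm

section Separation

variable {α : Type*} [Fintype α] [DecidableEq α] {X : Type*}

theorem alternatingGroup_le_map_lift_ker (hα : 5 ≤ Nat.card α) {s t : X → Equiv.Perm α}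
    (ht : Function.Surjective (FreeGroup.lift t))
    (hst : ¬ ∃ φ : MulAut (Equiv.Perm α), ∀ x, φ (t x) = s x) :
    alternatingGroup α ≤ (FreeGroup.lift s).ker.map (FreeGroup.lift t) := by
  have hnormal : ((FreeGroup.lift s).ker.map (FreeGroup.lift t)).Normal :=
    Subgroup.Normal.map inferInstance _ ht
  refine Equiv.Perm.alternatingGroup_le_of_normal hα ?_
  rw [Subgroup.nontrivial_iff_ne_bot, Ne, Subgroup.map_eq_bot_iff]
  exact fun h => hst (exists_mulAut_of_ker_lift_le ht h)

/-- Commutators of two normal subgroups lie in their intersection, and the alternating group is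
perfect. -/
theorem alternatingGroup_le_map_lift_iInf_ker (hα : 5 ≤ Nat.card α) {t : X → Equiv.Perm α}
    (ht : Function.Surjective (FreeGroup.lift t)) (S : Finset (X → Equiv.Perm α))
    (hS : ∀ s ∈ S, ¬ ∃ φ : MulAut (Equiv.Perm α), ∀ x, φ (t x) = s x) :
    alternatingGroup α ≤ (⨅ s ∈ S, (FreeGroup.lift s).ker).map (FreeGroup.lift t) := by
  classical
  induction S using Finset.induction_on with
  | empty => simp [← MonoidHom.range_eq_map, MonoidHom.range_eq_top.mpr ht]
  | insert s S _ ih =>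
    have hnormal : (⨅ s ∈ S, (FreeGroup.lift s).ker).Normal :=
      Subgroup.normal_iInf_normal fun _ => Subgroup.normal_iInf_normal fun _ => inferInstance
    rw [Finset.iInf_insert, ← commutator_alternatingGroup_eq_self hα]
    refine (Subgroup.commutator_mono
      (alternatingGroup_le_map_lift_ker hα ht (hS s (Finset.mem_insert_self s S)))
      (ih fun r hr => hS r (Finset.mem_insert_of_mem hr))).trans ?_
    rw [← Subgroup.map_commutator]
    exact Subgroup.map_mono (Subgroup.commutator_le_inf _ _)

/-- A generating tuple `t` can be separated by words from all tuples outside its orbit. -/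
theorem exists_word_supported_on_orbit [Finite X] (hα : 5 ≤ Nat.card α) {t : X → Equiv.Perm α}
    (ht : Function.Surjective (FreeGroup.lift t)) {g : Equiv.Perm α}
    (hg : g ∈ alternatingGroup α) :
    ∃ u : FreeGroup X, FreeGroup.lift t u = g ∧ ∀ s : X → Equiv.Perm α,
      (¬ ∃ φ : MulAut (Equiv.Perm α), ∀ x, φ (t x) = s x) → FreeGroup.lift s u = 1 := by
  classical
  obtain ⟨u, hu, rfl⟩ := alternatingGroup_le_map_lift_iInf_ker hα ht
    (Set.toFinite {s | ¬ ∃ φ : MulAut (Equiv.Perm α), ∀ x, φ (t x) = s x}).toFinset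
    (by simp) hg
  refine ⟨u, rfl, fun s hs => ?_⟩
  simp only [SetLike.mem_coe, Subgroup.mem_iInf, Set.Finite.mem_toFinset] at hu
  exact hu s hs

/-- The tuple listing every element of `G`, followed by `a`. -/
def enumerationTuple {G : Type*} (a : G) : Option G → G := fun o => o.getD a

theorem lift_enumerationTuple_surjective {G : Type*} [Group G] (a : G) :
    Function.Surjective (FreeGroup.lift (enumerationTuple a)) := fun g =>
  ⟨FreeGroup.of (some g), by simp [enumerationTuple]⟩

/-- The listed elements force `φ` to fix `a`, so distinct last entries give distinct orbits. -/
theorem eq_of_mulAut_enumerationTuple {G : Type*} [Group G] {a b : G} {φ : MulAut G}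
    (h : ∀ x, φ (enumerationTuple a x) = enumerationTuple b x) : a = b :=
  (h (some a)).symm.trans (h none)

theorem exists_word_interpolating (hα : 5 ≤ Nat.card α) {f : Equiv.Perm α → Equiv.Perm α}
    (T : Finset (Equiv.Perm α)) (hf : ∀ a ∈ T, f a ∈ alternatingGroup α) :
    ∃ w : FreeGroup (Option (Equiv.Perm α)),
      (∀ a ∈ T, FreeGroup.lift (enumerationTuple a) w = f a) ∧
      ∀ s, (∀ a ∈ T, ¬ ∃ φ : MulAut (Equiv.Perm α), ∀ x, φ (enumerationTuple a x) = s x) →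
        FreeGroup.lift s w = 1 := by
  induction T using Finset.induction_on with
  | empty => exact ⟨1, by simp⟩
  | insert b T hb ih =>
    obtain ⟨w, hw, hw'⟩ := ih fun a ha => hf a (Finset.mem_insert_of_mem ha)
    obtain ⟨u, hu, hu'⟩ := exists_word_supported_on_orbit hα
      (lift_enumerationTuple_surjective b) (hf b (Finset.mem_insert_self b T))
    refine ⟨u * w, fun a ha => ?_, fun s hs => ?_⟩
    · rw [map_mul]
      rcases Finset.mem_insert.mp ha with rfl | ha
      · rw [hu, hw', mul_one]
        rintro c hc ⟨φ, hφ⟩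
        exact hb (eq_of_mulAut_enumerationTuple hφ ▸ hc)
      · rw [hw a ha, hu', one_mul]
        rintro ⟨φ, hφ⟩
        exact hb (eq_of_mulAut_enumerationTuple hφ ▸ ha)
    · rw [map_mul, hu' s (hs b (Finset.mem_insert_self b T)),
        hw' s fun a ha => hs a (Finset.mem_insert_of_mem ha), one_mul]

theorem isVerbalImage_of_pow_mem (hα : 5 ≤ Nat.card α) {A : Set (Equiv.Perm α)}
    (hA : IsAutInvariant A) (m : ℕ) (hm : ∀ g : Equiv.Perm α, g ^ m ∈ A)
    (hsub : ∀ a ∈ A, a * (a ^ m)⁻¹ ∈ alternatingGroup α) :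
    IsVerbalImage A := by
  classical
  obtain ⟨w, hw, hw'⟩ := exists_word_interpolating hα (f := fun a => a * (a ^ m)⁻¹)
    (Set.toFinite A).toFinset (by simpa using hsub)
  simp only [Set.Finite.mem_toFinset] at hw hw'
  have hval (a) (ha : a ∈ A) :
      FreeGroup.lift (enumerationTuple a) (w * FreeGroup.of none ^ m) = a := by
    simp [hw a ha, enumerationTuple]
  convert isVerbalImage_range_lift (G := Equiv.Perm α) (w * FreeGroup.of none ^ m)
  refine Set.Subset.antisymm (fun a ha => ⟨_, hval a ha⟩) ?_
  rintro _ ⟨s, rfl⟩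
  by_cases hs : ∃ a ∈ A, ∃ φ : MulAut (Equiv.Perm α), ∀ x, φ (enumerationTuple a x) = s x
  · obtain ⟨a, ha, φ, hφ⟩ := hs
    obtain rfl : (fun x => φ (enumerationTuple a x)) = s := funext hφ
    refine Set.mem_of_eq_of_mem ?_ (hA φ a ha)
    refine (map_lift_apply φ.toMonoidHom (enumerationTuple a) _).symm.trans ?_
    rw [hval a ha]
    rfl
  -- Off the orbits `w` is trivial, leaving only the `m`-th power of the last entry.
  · push Not at hs
    simpa [hw' s (by simpa using hs)] using hm (s none)

end Separation

theorem exists_odd_pow_mem_twoPowerElements (G : Type*) [Group G] [Finite G] :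
    ∃ m : ℕ, Odd m ∧ ∀ g : G, g ^ m ∈ twoPowerElements G := by
  -- `m` is the odd part of the group order.
  obtain ⟨j, m, hm, hcard⟩ := Nat.exists_eq_two_pow_mul_odd (Nat.card_pos (α := G)).ne'
  refine ⟨m, hm, fun g => ?_⟩
  have h : orderOf (g ^ m) ∣ 2 ^ j :=
    orderOf_dvd_of_pow_eq_one (by rw [← pow_mul, mul_comm, ← hcard, pow_card_eq_one'])
  obtain ⟨i, _, hi⟩ := (Nat.dvd_prime_pow Nat.prime_two).mp h
  exact ⟨i, hi⟩

theorem theoremA (n : ℕ) (hn : 5 ≤ n) (A : Set (Equiv.Perm (Fin n))) :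
    IsVerbalImage A ↔
      (IsAutInvariant A ∧ A ⊆ (alternatingGroup (Fin n) : Set (Equiv.Perm (Fin n))) ∧ 1 ∈ A) ∨
      (∃ B : Set (Equiv.Perm (Fin n)),
        IsAutInvariant B ∧ A = B ∪ twoPowerElements (Equiv.Perm (Fin n))) := by
  have hcard : 5 ≤ Nat.card (Fin n) := by simpa using hn
  constructor
  · rintro ⟨k, w, rfl⟩
    by_cases hw : verbalImage w (Equiv.Perm (Fin n)) ⊆
        (alternatingGroup (Fin n) : Set (Equiv.Perm (Fin n)))
    · exact .inl ⟨verbalImage_isAutInvariant w _, hw, one_mem_verbalImage w _⟩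
    · exact .inr ⟨_, verbalImage_isAutInvariant w _,
        (Set.union_eq_left.mpr (twoPowerElements_subset_verbalImage w hw)).symm⟩
  · rintro (⟨hA, hsub, hone⟩ | ⟨B, hB, rfl⟩)
    · refine isVerbalImage_of_pow_mem hcard hA 0 (by simpa using hone) fun a ha => ?_
      simpa using hsub ha
    · obtain ⟨m, hm, hpow⟩ := exists_odd_pow_mem_twoPowerElements (Equiv.Perm (Fin n))
      refine isVerbalImage_of_pow_mem hcard ?_ m (fun g => .inr (hpow g)) fun a _ => ?_
      · rintro φ a (ha | ha)
        · exact .inl (hB φ a ha)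
        · exact .inr (twoPowerElements_isAutInvariant _ φ a ha)
      · rw [Equiv.Perm.mem_alternatingGroup]
        rcases Int.units_eq_one_or (Equiv.Perm.sign a) with ha | ha <;> simp [ha, hm.neg_one_pow]
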